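/- For $p, d \in \mathbb{N}$ and $\lambda, \omega > 0$, let $\mathcal{G}_{p,d}$ be the set of simple graphs on the vertex set $\{1,\dots,p\}$ in which every vertex has degree at most $d$, and let $\mathcal{G}_{p,d}(\lambda,\omega)$ be the class of Ising models $$\mathbb{P}_{\theta(G)}(x) = \frac{1}{Z(\theta)} \exp\Big\{ \sum_{(s,t)\in E} \theta_{st}\, x_s x_t \Big\}, \qquad x \in \{-1,+1\}^p,$$ where $Z(\theta)$ is the normalizing constant, $G=(V,E) \in \mathcal{G}_{p,d}$, $\theta_{st} = 0$ for $(s,t)\notin E$, $|\theta_{st}| \ge \lambda$ for all $(s,t)\in E$, and $\sum_{t : (s,t)\in E} |\theta_{st}| \le \omega$ for all $s\in V$. A graph decoder based on $n$ samples is a function $\phi$ from $(\{-1,+1\}^p)^n$ to the graphs on $\{1,\dots,p\}$; it is applied to $n$ i.i.d. samples $\mathbf{X}_1^n$ from $\mathbb{P}_{\theta(G)}$. There are an absolute constant $c > 0$ and an integer $d_0$ such that the following holds for all $d \ge d_0$, all $p > d$, all $\lambda > 0$ and all $\omega \ge \lambda d$. If, for some $n$, a graph decoder $\phi$ satisfies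 $$\min_{\mathbb{P}_{\theta(G)} \in \mathcal{G}_{p,d}(\lambda,\omega)} \mathbb{P}_{\theta(G)}\big[\phi(\mathbf{X}_1^n) = G\big] \ \ge\ \frac12,$$ then $$n > c \, \max\{d^2, \lambda^{-2}\} \log p .$$ The same holds when the edge weights are known: for all such $p, d, \lambda, \omega$ there is an assignment $G \mapsto \theta(G)$ of edge weights to the graphs $G \in \mathcal{G}_{p,d}$, with $\mathbb{P}_{\theta(G)} \in \mathcal{G}_{p,d}(\lambda,\omega)$ for every $G$, such that for every $n$, any decoder (which may depend on this assignment) with $\mathbb{P}_{\theta(G)}[\phi(\mathbf{X}_1^n) = G] \ge \frac12$ for all $G \in \mathcal{G}_{p,d}$ needs $n > c \max\{d^2,\lambda^{-2}\} \log p$ samples. -/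

import Mathlib

noncomputable section

open scoped Classical in
/-- The family of graphs on the vertex set `Fin p` in which every vertex has degree at most `d`. -/
def boundedDegreeGraphs (p d : ℕ) : Set (SimpleGraph (Fin p)) :=
  {G | ∀ s, G.degree s ≤ d}

/-- A vector of edge weights `θ_{st} = θ_{ts}`, indexed by unordered pairs of vertices. -/
abbrev EdgeWeights (p : ℕ) : Type := Sym2 (Fin p) → ℝ

/-- A configuration in `{-1, +1}^p`. -/
abbrev SpinConfig (p : ℕ) : Type := Fin p → ℤˣ

/-- The product `x_s x_t` of the two spins at the ends of the pair `{s, t}`. -/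
def spinProduct {p : ℕ} (x : SpinConfig p) : Sym2 (Fin p) → ℝ :=
  Sym2.lift ⟨fun s t => ((x s : ℤ) : ℝ) * ((x t : ℤ) : ℝ), fun _ _ => mul_comm _ _⟩

open scoped Classical in
/-- The exponent `∑_{(s,t) ∈ E} θ_{st} x_s x_t`, each edge being counted once. -/
def isingExponent {p : ℕ} (G : SimpleGraph (Fin p)) (θ : EdgeWeights p) (x : SpinConfig p) : ℝ :=
  ∑ e ∈ G.edgeFinset, θ e * spinProduct x e

/-- The normalization factor of the Ising model. -/
def isingNormalizer {p : ℕ} (G : SimpleGraph (Fin p)) (θ : EdgeWeights p) : ℝ :=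
  ∑ x : SpinConfig p, Real.exp (isingExponent G θ x)

/-- The probability mass function of the Ising model on `G` with edge weights `θ`. -/
def isingMass {p : ℕ} (G : SimpleGraph (Fin p)) (θ : EdgeWeights p) (x : SpinConfig p) : ℝ :=
  Real.exp (isingExponent G θ x) / isingNormalizer G θ

open scoped Classical in
/-- The class of Ising models with degrees at most `d`, minimum edge weight at least `lam` and
maximum neighborhood weight at most `om`. A minimum over the empty edge set counts as `+∞`, so
the edgeless graph with zero weights belongs to the class. -/
structure InIsingClass {p : ℕ} (d : ℕ) (lam om : ℝ) (G : SimpleGraph (Fin p))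
    (θ : EdgeWeights p) : Prop where
  degree_le : G ∈ boundedDegreeGraphs p d
  support : ∀ e, θ e ≠ 0 → e ∈ G.edgeSet
  le_minWeight : ∀ e ∈ G.edgeSet, lam ≤ |θ e|
  neighborhoodWeight_le : ∀ s, ∑ t ∈ G.neighborFinset s, |θ s(s, t)| ≤ om

/-- A graph decoder: a function from data sets of `n` configurations to graphs. -/
abbrev GraphDecoder (p n : ℕ) : Type := (Fin n → SpinConfig p) → SimpleGraph (Fin p)

open scoped Classical in
/-- The probability that the decoder `φ` outputs the graph `G` when its input consists of `n`
independent samples from the Ising model on `G` with edge weights `θ`. -/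
def recoveryProb {p n : ℕ} (G : SimpleGraph (Fin p)) (θ : EdgeWeights p)
    (φ : GraphDecoder p n) : ℝ :=
  ∑ X : Fin n → SpinConfig p, if φ X = G then ∏ i, isingMass G θ (X i) else 0

end

/-! A strongly coupled path hides a weak chord. The candidates are the path with weight `a = lam * d
/ 4` on its edges plus one chord `{j, j + 2}` of weight `lam`; the reference model is the bare path.
Since `x_j` and `x_{j+2}` agree `cosh (2 * a)` times as often as they differ
(`linePath_correlation`), adding the chord barely changes the law: the likelihood ratio has second
moment at most `1 + 4 * lam ^ 2 / cosh (2 * a)`, hence at most `1 + 32 / max (d ^ 2) (lam ^ (-2))`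
(`second_moment_tilt_le`, `tilt_bound_le`). By Cauchy–Schwarz, a decoder that recovers all `p - 2`
candidates must give each of these disjoint outputs a non-negligible probability under the reference
model, which forces `(p - 2) / 4 ≤ (1 + κ) ^ n` (`card_div_four_le_of_recoveryProb`). -/

/-! ### Spin flips across a cut -/

/-- Flip the spins at the vertices satisfying `P`. -/
def flipSpins {p : ℕ} (P : Fin p → Prop) [DecidablePred P] (x : SpinConfig p) : SpinConfig p :=
  fun i => if P i then -x i else x i

theorem flipSpins_involutive {p : ℕ} (P : Fin p → Prop) [DecidablePred P] :
    Function.Involutive (flipSpins P) := by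
  intro x
  funext i
  by_cases h : P i <;> simp [flipSpins, h]

theorem spinProduct_mk {p : ℕ} (x : SpinConfig p) (s t : Fin p) :
    spinProduct x s(s, t) = ((x s : ℤ) : ℝ) * ((x t : ℤ) : ℝ) := rfl

theorem spin_mul_self {p : ℕ} (x : SpinConfig p) (s : Fin p) :
    ((x s : ℤ) : ℝ) * ((x s : ℤ) : ℝ) = 1 := by
  rcases Int.units_eq_one_or (x s) with h | h <;> simp [h]

theorem spinProduct_mul_self {p : ℕ} (x : SpinConfig p) (e : Sym2 (Fin p)) :
    spinProduct x e * spinProduct x e = 1 := by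
  induction e with
  | _ s t =>
    rw [spinProduct_mk, mul_mul_mul_comm, spin_mul_self, spin_mul_self, one_mul]

theorem spinProduct_mul_spinProduct {p : ℕ} (x : SpinConfig p) (s t u : Fin p) :
    spinProduct x s(s, t) * spinProduct x s(t, u) = spinProduct x s(s, u) := by
  simp only [spinProduct_mk]
  linear_combination ((x s : ℤ) : ℝ) * ((x u : ℤ) : ℝ) * spin_mul_self x t

theorem spinProduct_flipSpins_of_iff {p : ℕ} (P : Fin p → Prop) [DecidablePred P]
    (x : SpinConfig p) {s t : Fin p} (h : P s ↔ P t) :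
    spinProduct (flipSpins P x) s(s, t) = spinProduct x s(s, t) := by
  by_cases hs : P s
  · have ht := h.1 hs
    simp [spinProduct_mk, flipSpins, hs, ht]
  · have ht : ¬ P t := fun h' => hs (h.2 h')
    simp [spinProduct_mk, flipSpins, hs, ht]

theorem spinProduct_flipSpins_of_cut {p : ℕ} (P : Fin p → Prop) [DecidablePred P]
    (x : SpinConfig p) {s t : Fin p} (hs : P s) (ht : ¬ P t) :
    spinProduct (flipSpins P x) s(s, t) = -spinProduct x s(s, t) := by
  simp [spinProduct_mk, flipSpins, hs, ht]

/-- Flipping one side of a cut crossed by a single edge changes the exponent only through that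
edge. -/
theorem isingExponent_flipSpins {p : ℕ} (G : SimpleGraph (Fin p)) (θ : EdgeWeights p)
    (P : Fin p → Prop) [DecidablePred P] {u v : Fin p} (huv : G.Adj u v) (hu : P u) (hv : ¬ P v)
    (hcut : ∀ s t, G.Adj s t → P s → ¬ P t → s = u ∧ t = v) (x : SpinConfig p) :
    isingExponent G θ (flipSpins P x)
      = isingExponent G θ x - 2 * θ s(u, v) * spinProduct x s(u, v) := by
  classical
  have he₀ : s(u, v) ∈ G.edgeFinset := by rwa [SimpleGraph.mem_edgeFinset]
  unfold isingExponent
  rw [← Finset.add_sum_erase _ _ he₀,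
    ← Finset.add_sum_erase _ (fun e => θ e * spinProduct x e) he₀,
    spinProduct_flipSpins_of_cut P x hu hv]
  have hrest : ∀ e ∈ G.edgeFinset.erase s(u, v),
      θ e * spinProduct (flipSpins P x) e = θ e * spinProduct x e := by
    intro e he
    rw [Finset.mem_erase, SimpleGraph.mem_edgeFinset] at he
    obtain ⟨hne, he⟩ := he
    induction e with
    | _ s t =>
      rw [SimpleGraph.mem_edgeSet] at he
      congr 1
      apply spinProduct_flipSpins_of_iff
      by_contra hiff
      by_cases hs : P s
      · have ht : ¬ P t := fun ht => hiff ⟨fun _ => ht, fun _ => hs⟩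
        obtain ⟨rfl, rfl⟩ := hcut s t he hs ht
        exact hne rfl
      · have ht : P t := by
          by_contra ht
          exact hiff ⟨fun h => absurd h hs, fun h => absurd h ht⟩
        obtain ⟨rfl, rfl⟩ := hcut t s he.symm ht hs
        exact hne Sym2.eq_swap
  rw [Finset.sum_congr rfl hrest]
  ring

/-! ### Biased signs and exponential tilts -/

theorem exp_mul_of_mul_self_eq_one (b : ℝ) {y : ℝ} (hy : y * y = 1) :
    Real.exp (b * y) = Real.cosh b + y * Real.sinh b := by
  rcases mul_self_eq_one_iff.1 hy with rfl | rfl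
  · simp [Real.cosh_add_sinh]
  · simp [Real.cosh_eq, Real.sinh_eq]
    ring

/-- A sign `y` whose value is reversed by a symmetry that tilts the weight by `exp (-2 a y)` has
weighted mean `tanh a`, also after multiplication with an invariant observable. -/
theorem sum_mul_sign_of_flip {Ω : Type*} [Fintype Ω] (w y g : Ω → ℝ) (a : ℝ) (τ : Ω → Ω)
    (hτ : Function.Involutive τ) (hy : ∀ x, y x * y x = 1) (hyτ : ∀ x, y (τ x) = -y x)
    (hg : ∀ x, g (τ x) = g x) (hw : ∀ x, w (τ x) = w x * Real.exp (-(2 * a) * y x)) :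
    (1 + Real.cosh (2 * a)) * ∑ x, w x * (y x * g x)
      = Real.sinh (2 * a) * ∑ x, w x * g x := by
  have h : ∑ x, w x * (y x * g x) = ∑ x, w (τ x) * (y (τ x) * g (τ x)) :=
    (Equiv.sum_comp hτ.toPerm (fun x => w x * (y x * g x))).symm
  have h2 : ∑ x, w (τ x) * (y (τ x) * g (τ x))
      = -(Real.cosh (2 * a) * ∑ x, w x * (y x * g x))
        + Real.sinh (2 * a) * ∑ x, w x * g x := by
    rw [Finset.mul_sum, Finset.mul_sum, ← Finset.sum_neg_distrib, ← Finset.sum_add_distrib]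
    refine Finset.sum_congr rfl fun x _ => ?_
    rw [hw, hyτ, hg, exp_mul_of_mul_self_eq_one _ (hy x), Real.cosh_neg, Real.sinh_neg]
    linear_combination (w x * g x * Real.sinh (2 * a)) * hy x
  linarith

/-- Two independent signs with bias `tanh a` agree `cosh (2 a)` times as often as they differ. -/
theorem cosh_mul_sum_sign_product {Ω : Type*} [Fintype Ω] (w y z : Ω → ℝ) {a : ℝ}
    (σ τ : Ω → Ω) (hσ : Function.Involutive σ) (hτ : Function.Involutive τ)
    (hy : ∀ x, y x * y x = 1) (hz : ∀ x, z x * z x = 1)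
    (hyσ : ∀ x, y (σ x) = -y x) (hzσ : ∀ x, z (σ x) = z x) (hzτ : ∀ x, z (τ x) = -z x)
    (hwσ : ∀ x, w (σ x) = w x * Real.exp (-(2 * a) * y x))
    (hwτ : ∀ x, w (τ x) = w x * Real.exp (-(2 * a) * z x)) :
    Real.cosh (2 * a) * (∑ x, w x - ∑ x, w x * (y x * z x))
      = ∑ x, w x + ∑ x, w x * (y x * z x) := by
  -- With `g = z`, then `g = 1`: the mean of `y z` is `tanh a ^ 2`.
  have h1 := sum_mul_sign_of_flip w y z a σ hσ hy hyσ hzσ hwσ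
  have h2 := sum_mul_sign_of_flip w z (fun _ => 1) a τ hτ hz hzτ (fun _ => rfl) hwτ
  simp only [mul_one] at h2
  have h3 : Real.cosh (2 * a) ^ 2 = Real.sinh (2 * a) ^ 2 + 1 := Real.cosh_sq _
  have hpos : (0 : ℝ) < 1 + Real.cosh (2 * a) := by linarith [Real.cosh_pos (2 * a)]
  apply mul_left_cancel₀ hpos.ne'
  linear_combination (-1 : ℝ) * (1 + Real.cosh (2 * a)) * h1 - Real.sinh (2 * a) * h2
    + (∑ x, w x) * h3

/-- The second moment of the likelihood ratio of an exponential tilt by a sign `f`. -/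
theorem second_moment_tilt_le {Ω : Type*} [Fintype Ω] (w f : Ω → ℝ) (hw : ∀ x, 0 < w x)
    (hf : ∀ x, f x * f x = 1) {C lam κ : ℝ} (hC : 0 < C) (hlam : 0 ≤ lam)
    (hbal : C * (∑ x, w x - ∑ x, w x * f x) = ∑ x, w x + ∑ x, w x * f x)
    (hκ : 4 * lam ^ 2 / C ≤ κ) :
    (∑ x, w x * Real.exp (2 * lam * f x)) * ∑ x, w x
      ≤ (1 + κ) * (∑ x, w x * Real.exp (lam * f x)) ^ 2 := by
  set Z := ∑ x, w x
  set m := ∑ x, w x * f x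
  have hmZ : m ≤ Z := by
    refine Finset.sum_le_sum fun x _ => ?_
    have : f x ≤ 1 := by nlinarith [hf x, sq_nonneg (f x - 1)]
    nlinarith [hw x]
  have hexp : ∀ b : ℝ, ∑ x, w x * Real.exp (b * f x)
      = ((Z + m) / 2) * Real.exp b + ((Z - m) / 2) * Real.exp (-b) := by
    intro b
    have : ∑ x, w x * Real.exp (b * f x) = Z * Real.cosh b + m * Real.sinh b := by
      rw [Finset.sum_mul, Finset.sum_mul, ← Finset.sum_add_distrib]
      refine Finset.sum_congr rfl fun x _ => ?_
      rw [exp_mul_of_mul_self_eq_one _ (hf x)]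
      ring
    rw [this, Real.cosh_eq, Real.sinh_eq]
    ring
  -- `B` is the mass of `f = -1`; by `hbal` the mass of `f = 1` is `C * B`.
  set B := (Z - m) / 2 with hB
  have hA : (Z + m) / 2 = C * B := by rw [hB]; linarith
  have hZ : Z = C * B + B := by linarith
  have hB0 : 0 ≤ B := by rw [hB]; linarith
  rw [hexp, hexp, hA, hZ]
  set t := Real.exp lam with ht
  have ht0 : 0 < t := Real.exp_pos _
  set s := Real.exp (-lam) with hs
  have hs0 : 0 < s := Real.exp_pos _
  have hts : t * s = 1 := by rw [ht, hs, ← Real.exp_add]; simp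
  have ht2 : Real.exp (2 * lam) = t ^ 2 := by rw [ht, ← Real.exp_nat_mul]; norm_num
  have hs2 : Real.exp (-(2 * lam)) = s ^ 2 := by
    rw [hs, ← Real.exp_nat_mul]; congr 1; push_cast; ring
  rw [ht2, hs2]
  have hss : 1 - 2 * lam ≤ s ^ 2 := by
    rw [← hs2]; linarith [Real.add_one_le_exp (-(2 * lam))]
  have hs1 : s ≤ 1 := by rw [hs]; exact Real.exp_le_one_iff.2 (by linarith)
  have hs21 : s ^ 2 ≤ 1 := pow_le_one₀ hs0.le hs1
  have hd : (t - s) ^ 2 ≤ 4 * lam ^ 2 * t ^ 2 := by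
    have e : t - s = t * (1 - s ^ 2) := by linear_combination s * hts
    have h1 : (1 - s ^ 2) ^ 2 ≤ (2 * lam) ^ 2 := pow_le_pow_left₀ (by linarith) (by linarith) 2
    rw [e, mul_pow]
    nlinarith [sq_nonneg t]
  have hκC : 4 * lam ^ 2 ≤ κ * C := (div_le_iff₀ hC).1 hκ
  have hκ0 : 0 ≤ κ := le_trans (by positivity) hκ
  -- The excess is the variance of a two-valued variable; the rare value supplies only one factor
  -- `B` per `C * B`, hence the gain `1 / C`.
  have hid : (C * B * t ^ 2 + B * s ^ 2) * (C * B + B)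
      = (C * B * t + B * s) ^ 2 + C * B ^ 2 * (t - s) ^ 2 := by ring
  have hmain : C * B ^ 2 * (t - s) ^ 2 ≤ κ * (C * B * t) ^ 2 := by
    calc C * B ^ 2 * (t - s) ^ 2 ≤ C * B ^ 2 * (κ * C * t ^ 2) := by
          apply mul_le_mul_of_nonneg_left _ (by positivity)
          exact hd.trans (mul_le_mul_of_nonneg_right hκC (by positivity))
      _ = κ * (C * B * t) ^ 2 := by ring
  have hle : κ * (C * B * t) ^ 2 ≤ κ * (C * B * t + B * s) ^ 2 := by
    apply mul_le_mul_of_nonneg_left _ hκ0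
    apply pow_le_pow_left₀ (by positivity)
    have : 0 ≤ B * s := by positivity
    linarith
  rw [hid]
  linarith

/-! ### Change of measure and counting -/

/-- Change of measure by the Cauchy–Schwarz inequality for `n` independent samples. -/
theorem sq_sum_filter_prod_le {Ω : Type*} [Fintype Ω] {n : ℕ} (P Q : Ω → ℝ) (hQ : ∀ x, 0 < Q x)
    (S : Finset (Fin n → Ω)) :
    (∑ X ∈ S, ∏ i, P (X i)) ^ 2
      ≤ (∑ X ∈ S, ∏ i, Q (X i)) * (∑ x, P x ^ 2 / Q x) ^ n := by
  rw [Fintype.sum_pow]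
  have hQn : ∀ X : Fin n → Ω, 0 < ∏ i, Q (X i) := fun X => Finset.prod_pos fun i _ => hQ _
  calc (∑ X ∈ S, ∏ i, P (X i)) ^ 2
      ≤ (∑ X ∈ S, ∏ i, Q (X i)) * ∑ X ∈ S, ∏ i, P (X i) ^ 2 / Q (X i) := by
        apply Finset.sum_sq_le_sum_mul_sum_of_sq_le_mul
        · exact fun X _ => (hQn X).le
        · exact fun X _ => Finset.prod_nonneg fun i _ => div_nonneg (sq_nonneg _) (hQ _).le
        · intro X _
          apply le_of_eq
          rw [← Finset.prod_mul_distrib, ← Finset.prod_pow]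
          refine Finset.prod_congr rfl fun i _ => ?_
          have := (hQ (X i)).ne'
          field_simp
    _ ≤ _ := by
        apply mul_le_mul_of_nonneg_left _ (Finset.sum_nonneg fun X _ => (hQn X).le)
        apply Finset.sum_le_univ_sum_of_nonneg
        exact fun X => Finset.prod_nonneg fun i _ => div_nonneg (sq_nonneg _) (hQ _).le

theorem isingNormalizer_pos {p : ℕ} (G : SimpleGraph (Fin p)) (θ : EdgeWeights p) :
    0 < isingNormalizer G θ :=
  Finset.sum_pos (fun _ _ => Real.exp_pos _) Finset.univ_nonempty

theorem isingMass_pos {p : ℕ} (G : SimpleGraph (Fin p)) (θ : EdgeWeights p) (x : SpinConfig p) :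
    0 < isingMass G θ x :=
  div_pos (Real.exp_pos _) (isingNormalizer_pos G θ)

theorem sum_isingMass {p : ℕ} (G : SimpleGraph (Fin p)) (θ : EdgeWeights p) :
    ∑ x, isingMass G θ x = 1 := by
  unfold isingMass
  rw [← Finset.sum_div]
  exact div_self (isingNormalizer_pos G θ).ne'

/-- If many distinct graphs are recovered with probability one half, and the second moments of
their likelihood ratios with respect to a reference model are small, then many samples are
needed. -/
theorem card_div_four_le_of_recoveryProb {p n : ℕ} {ι : Type*} [Fintype ι] [Nonempty ι]
    (Γ : ι → SimpleGraph (Fin p)) (hΓ : Function.Injective Γ) (θ : ι → EdgeWeights p)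
    (G₀ : SimpleGraph (Fin p)) (θ₀ : EdgeWeights p) (φ : GraphDecoder p n) {κ : ℝ}
    (hκ : ∀ j, ∑ x, isingMass (Γ j) (θ j) x ^ 2 / isingMass G₀ θ₀ x ≤ 1 + κ)
    (hφ : ∀ j, 1 / 2 ≤ recoveryProb (Γ j) (θ j) φ) :
    (Fintype.card ι : ℝ) / 4 ≤ (1 + κ) ^ n := by
  classical
  set q : (Fin n → SpinConfig p) → ℝ := fun X => ∏ i, isingMass G₀ θ₀ (X i) with hq
  have hq0 : ∀ X, 0 ≤ q X := fun X => Finset.prod_nonneg fun i _ => (isingMass_pos _ _ _).le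
  have hone : ∀ j, (1 : ℝ) / 4 ≤ (∑ X with φ X = Γ j, q X) * (1 + κ) ^ n := by
    intro j
    have h1 := sq_sum_filter_prod_le (isingMass (Γ j) (θ j)) (isingMass G₀ θ₀)
      (isingMass_pos _ _) ({X | φ X = Γ j} : Finset (Fin n → SpinConfig p))
    have h2 : (1 : ℝ) / 2 ≤ ∑ X with φ X = Γ j, ∏ i, isingMass (Γ j) (θ j) (X i) := by
      refine (hφ j).trans_eq ?_
      rw [Finset.sum_filter]
      unfold recoveryProb
      refine Finset.sum_congr rfl fun X _ => ?_
      by_cases h : φ X = Γ j <;> simp [h]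
    have h3 : (1 : ℝ) / 4
        ≤ (∑ X with φ X = Γ j, ∏ i, isingMass (Γ j) (θ j) (X i)) ^ 2 := by
      calc (1 : ℝ) / 4 = (1 / 2) ^ 2 := by norm_num
        _ ≤ _ := pow_le_pow_left₀ (by norm_num) h2 2
    refine h3.trans (h1.trans ?_)
    apply mul_le_mul_of_nonneg_left _ (Finset.sum_nonneg fun X _ => hq0 X)
    apply pow_le_pow_left₀ _ (hκ j)
    exact Finset.sum_nonneg fun x _ => div_nonneg (sq_nonneg _) (isingMass_pos _ _ _).le
  have htot : ∑ j, ∑ X with φ X = Γ j, q X ≤ 1 := by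
    have hdisj : ∑ j, ∑ X with φ X = Γ j, q X
        = ∑ X ∈ Finset.univ.biUnion
            (fun j => ({X | φ X = Γ j} : Finset (Fin n → SpinConfig p))), q X := by
      rw [Finset.sum_biUnion]
      intro i _ j _ hij
      refine Finset.disjoint_left.2 fun X hi hj => hij (hΓ ?_)
      rw [← (Finset.mem_filter.1 hi).2, (Finset.mem_filter.1 hj).2]
    rw [hdisj]
    calc _ ≤ ∑ X, q X := Finset.sum_le_univ_sum_of_nonneg hq0
      _ = 1 := by rw [hq, ← Fintype.sum_pow, sum_isingMass, one_pow]
  have hpow : 0 ≤ (1 + κ) ^ n := by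
    apply pow_nonneg
    refine le_trans ?_ (hκ (Classical.arbitrary ι))
    exact Finset.sum_nonneg fun x _ => div_nonneg (sq_nonneg _) (isingMass_pos _ _ _).le
  calc (Fintype.card ι : ℝ) / 4 = ∑ _j : ι, (1 : ℝ) / 4 := by simp; ring
    _ ≤ ∑ j, (∑ X with φ X = Γ j, q X) * (1 + κ) ^ n := Finset.sum_le_sum fun j _ => hone j
    _ = (∑ j, ∑ X with φ X = Γ j, q X) * (1 + κ) ^ n := by rw [Finset.sum_mul]
    _ ≤ 1 * (1 + κ) ^ n := mul_le_mul_of_nonneg_right htot hpow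
    _ = _ := one_mul _

/-! ### The chorded paths and their weights -/

/-- The path `0 - 1 - ⋯ - (p - 1)`. -/
def linePath (p : ℕ) : SimpleGraph (Fin p) where
  Adj s t := s.val + 1 = t.val ∨ t.val + 1 = s.val
  symm := ⟨fun _ _ h => h.symm⟩
  loopless := ⟨fun s h => by omega⟩

/-- The path with the chord `{j, j + 2}` added. -/
def chordedPath (p : ℕ) (j : Fin (p - 2)) : SimpleGraph (Fin p) where
  Adj s t := (s.val + 1 = t.val ∨ t.val + 1 = s.val) ∨
    (s.val = j.val ∧ t.val = j.val + 2) ∨ (t.val = j.val ∧ s.val = j.val + 2)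
  symm := ⟨fun _ _ h => h.imp Or.symm Or.symm⟩
  loopless := ⟨fun s h => by omega⟩

theorem chordedPath_injective (p : ℕ) : Function.Injective (chordedPath p) := by
  intro i j hij
  have h : (chordedPath p i).Adj ⟨i.val, by omega⟩ ⟨i.val + 2, by omega⟩ :=
    Or.inr (Or.inl ⟨rfl, rfl⟩)
  rw [hij] at h
  simp only [chordedPath] at h
  exact Fin.ext (by omega)

open scoped Classical in
theorem degree_chordedPath_le (p : ℕ) (j : Fin (p - 2)) (s : Fin p) :
    (chordedPath p j).degree s ≤ 4 := by
  rw [← SimpleGraph.card_neighborFinset_eq_degree,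
    ← Finset.card_map Fin.valEmbedding]
  calc _ ≤ ({s.val - 1, s.val + 1, s.val - 2, s.val + 2} : Finset ℕ).card := by
        apply Finset.card_le_card
        intro k hk
        obtain ⟨t, ht, rfl⟩ := Finset.mem_map.1 hk
        rw [SimpleGraph.mem_neighborFinset] at ht
        simp only [chordedPath] at ht
        simp only [Fin.valEmbedding_apply, Finset.mem_insert, Finset.mem_singleton]
        omega
    _ ≤ 4 := Finset.card_le_four

open scoped Classical in
/-- Weight `a` on the edges of the path and `lam` on all other edges if all degrees are at most
four, and weight `lam` on all edges otherwise. -/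
noncomputable def pathWeights (p : ℕ) (a lam : ℝ) (G : SimpleGraph (Fin p)) : EdgeWeights p := fun e =>
  if e ∈ G.edgeSet then
    if e ∈ (linePath p).edgeSet ∧ ∀ s, G.degree s ≤ 4 then a else lam
  else 0

/-- Degrees at most four bound a neighborhood by `4 * (lam * d / 4) = lam * d`; otherwise every edge
has weight `lam` and the degree bound `d` suffices. The assumption `4 ≤ d` keeps the path weight
above `lam`. -/
theorem inIsingClass_pathWeights {p d : ℕ} {lam om : ℝ} (hd : 4 ≤ d) (hlam : 0 < lam)
    (hom : lam * d ≤ om) {G : SimpleGraph (Fin p)} (hG : G ∈ boundedDegreeGraphs p d) :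
    InIsingClass d lam om G (pathWeights p (lam * d / 4) lam G) := by
  classical
  have hd' : (4 : ℝ) ≤ d := by exact_mod_cast hd
  have ha : lam ≤ lam * d / 4 := by nlinarith
  refine ⟨hG, ?_, ?_, ?_⟩
  · intro e he
    by_contra h
    exact he (if_neg h)
  · intro e he
    unfold pathWeights
    rw [if_pos he]
    split_ifs
    · exact ha.trans (le_abs_self _)
    · exact le_abs_self _
  · intro s
    by_cases h4 : ∀ s, G.degree s ≤ 4
    · calc _ ≤ ∑ t ∈ G.neighborFinset s, lam * d / 4 := by
            refine Finset.sum_le_sum fun t _ => ?_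
            unfold pathWeights
            split_ifs
            · exact (abs_of_nonneg (by linarith)).le
            · rw [abs_of_pos hlam]; exact ha
            · rw [abs_zero]; linarith
        _ = G.degree s * (lam * d / 4) := by simp
        _ ≤ 4 * (lam * d / 4) := by
            apply mul_le_mul_of_nonneg_right _ (by linarith)
            exact_mod_cast h4 s
        _ ≤ om := by linarith
    · calc _ ≤ ∑ t ∈ G.neighborFinset s, lam := by
            refine Finset.sum_le_sum fun t _ => ?_
            unfold pathWeights
            split_ifs with h1 h2
            · exact absurd h2.2 h4
            · exact (abs_of_pos hlam).le
            · rw [abs_zero]; exact hlam.le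
        _ = G.degree s * lam := by simp
        _ ≤ d * lam := by
            apply mul_le_mul_of_nonneg_right _ hlam.le
            exact_mod_cast hG s
        _ ≤ om := by linarith

theorem isingExponent_chordedPath {p : ℕ} (a lam : ℝ) (j : Fin (p - 2)) (x : SpinConfig p) :
    isingExponent (chordedPath p j) (pathWeights p a lam (chordedPath p j)) x
      = isingExponent (linePath p) (fun _ => a) x
        + lam * spinProduct x s(⟨j.val, by omega⟩, ⟨j.val + 2, by omega⟩) := by
  classical
  set c : Sym2 (Fin p) := s(⟨j.val, by omega⟩, ⟨j.val + 2, by omega⟩) with hc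
  have hc0 : c ∉ (linePath p).edgeSet := by
    rw [hc, SimpleGraph.mem_edgeSet]
    simp only [linePath]
    omega
  have hmem : ∀ e, e ∈ (chordedPath p j).edgeSet ↔ e = c ∨ e ∈ (linePath p).edgeSet := by
    intro e
    induction e with
    | _ s t =>
      simp only [SimpleGraph.mem_edgeSet, chordedPath, linePath, hc, Sym2.eq_iff, Fin.ext_iff]
      tauto
  have hE : (chordedPath p j).edgeFinset = insert c (linePath p).edgeFinset := by
    ext e
    rw [SimpleGraph.mem_edgeFinset, hmem, Finset.mem_insert, SimpleGraph.mem_edgeFinset]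
  unfold isingExponent
  rw [hE, Finset.sum_insert (by rwa [SimpleGraph.mem_edgeFinset]), add_comm]
  have hdeg := degree_chordedPath_le p j
  congr 1
  · refine Finset.sum_congr rfl fun e he => ?_
    rw [SimpleGraph.mem_edgeFinset] at he
    unfold pathWeights
    rw [if_pos ((hmem e).2 (Or.inr he)), if_pos ⟨he, hdeg⟩]
  · unfold pathWeights
    rw [if_pos ((hmem c).2 (Or.inl rfl)), if_neg fun h => hc0 h.1]

theorem exp_isingExponent_linePath_flip {p : ℕ} (a : ℝ) (k : ℕ) (hk : k + 1 < p)
    (x : SpinConfig p) :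
    Real.exp (isingExponent (linePath p) (fun _ => a) (flipSpins (fun i => i.val ≤ k) x))
      = Real.exp (isingExponent (linePath p) (fun _ => a) x)
        * Real.exp (-(2 * a) * spinProduct x s(⟨k, by omega⟩, ⟨k + 1, hk⟩)) := by
  rw [isingExponent_flipSpins (linePath p) (fun _ => a) (fun i => i.val ≤ k)
    (u := ⟨k, by omega⟩) (v := ⟨k + 1, hk⟩) (Or.inl rfl) le_rfl (by simp), ← Real.exp_add]
  · congr 1
    ring
  · intro s t hst hs ht
    simp only [linePath] at hst
    simp only [Fin.ext_iff]
    omega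

/-- The sign on the chord is the product of the signs on two consecutive path edges. Flipping an
initial segment of the path reverses exactly one of them, so they behave as independent signs of
bias `tanh a`. -/
theorem linePath_correlation {p : ℕ} (a : ℝ) (j : Fin (p - 2)) :
    let w := fun x : SpinConfig p => Real.exp (isingExponent (linePath p) (fun _ => a) x)
    let f := fun x : SpinConfig p =>
      spinProduct x s(⟨j.val, by omega⟩, ⟨j.val + 2, by omega⟩)
    Real.cosh (2 * a) * (∑ x, w x - ∑ x, w x * f x) = ∑ x, w x + ∑ x, w x * f x := by
  intro w f
  have h := cosh_mul_sum_sign_product w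
    (fun x => spinProduct x s(⟨j.val, by omega⟩, ⟨j.val + 1, by omega⟩))
    (fun x => spinProduct x s(⟨j.val + 1, by omega⟩, ⟨j.val + 2, by omega⟩))
    (a := a) (flipSpins fun i => i.val ≤ j.val) (flipSpins fun i => i.val ≤ j.val + 1)
    (flipSpins_involutive _) (flipSpins_involutive _)
    (fun x => spinProduct_mul_self x _) (fun x => spinProduct_mul_self x _)
    (fun x => spinProduct_flipSpins_of_cut _ x le_rfl (by simp))
    (fun x => spinProduct_flipSpins_of_iff _ x (by simp))
    (fun x => spinProduct_flipSpins_of_cut _ x le_rfl (by simp))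
    (fun x => exp_isingExponent_linePath_flip a j.val (by omega) x)
    (fun x => exp_isingExponent_linePath_flip a (j.val + 1) (by omega) x)
  simpa only [spinProduct_mul_spinProduct] using h

theorem second_moment_chordedPath_le {p : ℕ} {a lam κ : ℝ} (hlam : 0 ≤ lam)
    (hκ : 4 * lam ^ 2 / Real.cosh (2 * a) ≤ κ) (j : Fin (p - 2)) :
    ∑ x, isingMass (chordedPath p j) (pathWeights p a lam (chordedPath p j)) x ^ 2
      / isingMass (linePath p) (fun _ => a) x ≤ 1 + κ := by
  have h := second_moment_tilt_le
    (fun x : SpinConfig p => Real.exp (isingExponent (linePath p) (fun _ => a) x))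
    (fun x => spinProduct x s(⟨j.val, by omega⟩, ⟨j.val + 2, by omega⟩))
    (fun x => Real.exp_pos _) (fun x => spinProduct_mul_self x _) (Real.cosh_pos _) hlam
    (linePath_correlation a j) hκ
  have hZ := isingNormalizer_pos (chordedPath p j) (pathWeights p a lam (chordedPath p j))
  have hZ₀ := isingNormalizer_pos (linePath p) (fun _ => a)
  have hterm : ∀ x, isingMass (chordedPath p j) (pathWeights p a lam (chordedPath p j)) x ^ 2
      / isingMass (linePath p) (fun _ => a) x
      = Real.exp (isingExponent (linePath p) (fun _ => a) x) * Real.exp (2 * lam *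
          spinProduct x s(⟨j.val, by omega⟩, ⟨j.val + 2, by omega⟩))
        * isingNormalizer (linePath p) (fun _ => a)
        / isingNormalizer (chordedPath p j) (pathWeights p a lam (chordedPath p j)) ^ 2 := by
    intro x
    unfold isingMass
    rw [isingExponent_chordedPath, Real.exp_add, mul_assoc 2, two_mul, Real.exp_add]
    have := (Real.exp_pos (isingExponent (linePath p) (fun _ => a) x)).ne'
    field_simp
  rw [Finset.sum_congr rfl fun x _ => hterm x, ← Finset.sum_div, ← Finset.sum_mul,
    div_le_iff₀ (by positivity)]
  refine h.trans_eq ?_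
  simp only [isingNormalizer, isingExponent_chordedPath, Real.exp_add]

/-! ### Numerical bounds and conclusion -/

/-- From `cosh u ≥ 1 + u ^ 2 / 2` at `u = lam * d / 2`: the quadratic term gives `32 / d ^ 2`, the
constant term `4 * lam ^ 2`. -/
theorem tilt_bound_le {d : ℕ} {lam : ℝ} (hd : 0 < d) (hlam : 0 < lam) :
    4 * lam ^ 2 / Real.cosh (2 * (lam * d / 4))
      ≤ 32 / max ((d : ℝ) ^ 2) (lam ^ (-2 : ℤ)) := by
  have hd' : (0 : ℝ) < d := by exact_mod_cast hd
  have hz : lam ^ (-2 : ℤ) = (lam ^ 2)⁻¹ := by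
    rw [zpow_neg]; norm_cast
  have hcosh : 1 + (2 * (lam * d / 4)) ^ 2 / 2 ≤ Real.cosh (2 * (lam * d / 4)) := by
    have hsinh : lam * d / 4 ≤ Real.sinh (lam * d / 4) :=
      Real.self_le_sinh_iff.2 (by positivity)
    have hsq := pow_le_pow_left₀ (by positivity) hsinh 2
    rw [Real.cosh_two_mul, Real.cosh_sq]
    linarith
  rw [div_le_div_iff₀ (Real.cosh_pos _) (lt_max_of_lt_left (by positivity)), hz,
    mul_max_of_nonneg _ _ (by positivity)]
  apply max_le
  · nlinarith
  · rw [mul_inv_cancel_right₀ (by positivity)]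
    nlinarith [sq_nonneg (2 * (lam * d / 4))]

theorem half_log_le_log_sub_two_div_four {p : ℕ} (hp : 100 ≤ p) :
    Real.log p / 2 ≤ Real.log (((p - 2 : ℕ) : ℝ) / 4) := by
  have hp' : (100 : ℝ) ≤ p := by exact_mod_cast hp
  rw [Nat.cast_sub (by omega), ← Real.log_sqrt (by linarith)]
  apply Real.log_le_log (Real.sqrt_pos.2 (by linarith))
  rw [Real.sqrt_le_left (by push_cast; linarith)]
  push_cast
  nlinarith

/-- The first part concerns unknown edge weights. In the second part the weight vector `Θ G` that
goes with each candidate graph `G` is fixed before the decoder is chosen, so that the decoder may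
depend on it: these are the known edge weights. -/
theorem corollary1 :
    ∃ c : ℝ, 0 < c ∧ ∃ d₀ : ℕ, ∀ p d : ℕ, d₀ ≤ d → d < p →
      ∀ lam om : ℝ, 0 < lam → lam * d ≤ om →
        (∀ (n : ℕ) (φ : GraphDecoder p n),
          (∀ (G : SimpleGraph (Fin p)) (θ : EdgeWeights p), InIsingClass d lam om G θ →
            1 / 2 ≤ recoveryProb G θ φ) →
          c * max ((d : ℝ) ^ 2) (lam ^ (-2 : ℤ)) * Real.log p < n) ∧
        (∃ Θ : SimpleGraph (Fin p) → EdgeWeights p,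
          (∀ G ∈ boundedDegreeGraphs p d, InIsingClass d lam om G (Θ G)) ∧
          ∀ (n : ℕ) (φ : GraphDecoder p n),
            (∀ G ∈ boundedDegreeGraphs p d, 1 / 2 ≤ recoveryProb G (Θ G) φ) →
            c * max ((d : ℝ) ^ 2) (lam ^ (-2 : ℤ)) * Real.log p < n) := by
  -- The bound `32 / R` and the loss of half the logarithm give `1 / 64`; halving again makes the
  -- inequality strict. The threshold `100` ensures `√p ≤ (p - 2) / 4`.
  refine ⟨1 / 128, by norm_num, 100, fun p d hd hdp lam om hlam hom => ?_⟩
  set Θ := pathWeights p (lam * d / 4) lam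
  have hΘ : ∀ G ∈ boundedDegreeGraphs p d, InIsingClass d lam om G (Θ G) :=
    fun G hG => inIsingClass_pathWeights (by omega) hlam hom hG
  have hmain : ∀ (n : ℕ) (φ : GraphDecoder p n),
      (∀ G ∈ boundedDegreeGraphs p d, 1 / 2 ≤ recoveryProb G (Θ G) φ) →
      1 / 128 * max ((d : ℝ) ^ 2) (lam ^ (-2 : ℤ)) * Real.log p < n := by
    intro n φ hφ
    set R := max ((d : ℝ) ^ 2) (lam ^ (-2 : ℤ))
    have hR : 0 < R := lt_max_of_lt_right (by positivity)
    have : Nonempty (Fin (p - 2)) := ⟨⟨0, by omega⟩⟩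
    have hcard := card_div_four_le_of_recoveryProb (chordedPath p) (chordedPath_injective p)
      (fun j => Θ (chordedPath p j)) (linePath p) (fun _ => lam * d / 4) φ
      (fun j => second_moment_chordedPath_le hlam.le (tilt_bound_le (by omega) hlam) j)
      (fun j => hφ _ fun s => (degree_chordedPath_le p j s).trans (by omega))
    rw [Fintype.card_fin] at hcard
    have hpos : (0 : ℝ) < ((p - 2 : ℕ) : ℝ) / 4 := by
      have : 0 < p - 2 := by omega
      positivity
    have hlog : Real.log (((p - 2 : ℕ) : ℝ) / 4) ≤ n * (32 / R) := by
      rw [Real.log_le_iff_le_exp hpos, Real.exp_nat_mul]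
      refine hcard.trans (pow_le_pow_left₀ (by positivity) ?_ n)
      rw [add_comm]
      exact Real.add_one_le_exp _
    have hhalf := half_log_le_log_sub_two_div_four (p := p) (by omega)
    have hlogp : 0 < Real.log p := Real.log_pos (by exact_mod_cast (by omega : 1 < p))
    have h : Real.log p / 2 ≤ n * 32 / R := by
      rw [← mul_div_assoc] at hlog
      exact hhalf.trans hlog
    rw [le_div_iff₀ hR] at h
    nlinarith [mul_pos hR hlogp]
  refine ⟨fun n φ hφ => hmain n φ fun G hG => hφ G _ (hΘ G hG), Θ, hΘ, hmain⟩
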